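/- Fix $n,m\in\mathbb N$, two modes $(A(1),C(1))$ and $(A(2),C(2))$ with $A(j)\in\mathbb R^{n\times n}$, $C(j)\in\mathbb R^{m\times n}$, an ordered set $L=(s_1,\dots,s_p)$ of distinct attacked sensors in $\{1,\dots,m\}$, and a sensor $s\in L$. Let $D\in\mathbb R^{m\times p}$ have entries $D_{uv}=1$ if $u=s_v$ and $D_{uv}=0$ otherwise; $C^s(j)$ and $D^s$ denote $s$-th rows. The true system has the constant mode $(A(1),C(1))$: $$x_{k+1}=A(1)x_k,\qquad y_k=C(1)x_k+D d_k,\qquad k\ge 0,$$ with initial state $x_0\in\mathbb R^n$ and attack inputs $d_k\in\mathbb R^p$; let $y^s(x_0,d,k)$ be the $s$-th entry of $y_k$. The attack $d$ on sensor $s$ is nonzero if $D^s d_k\ne0$ for some $k$. It is unambiguously identifiable at time $t$ (for the true initial state $x_0$) if there is no $x_0^*\in\mathbb R^n$ with $y^s(x_0,d,k)=y^s(x_0^*,0,k)$ for all $0\le k\le t$. Let $\mathcal O^s_{t,j}$ be the $t\times n$ matrix with rows $C^s(j)A(j)^k$, $0\le k\le t-1$. The adversary guesses the mode $(A(2),C(2))$: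 an attack $d$ is called admissible if it is nonzero on sensor $s$ and, for every $t$, the vector $(D^sd_0,\dots,D^sd_{t-1})^T$ lies in the image of $\mathcal O^s_{t,2}$. For $j=1,2$ let $\Lambda^j\subset\mathbb C$ be the set of eigenvalues of $A(j)$. For each $\lambda\in\Lambda^j$ choose a maximal linearly independent set of generalized eigenvectors of $A(j)$ for $\lambda$ (that is, a basis of the generalized eigenspace in $\mathbb C^n$), arranged in $\ell$ Jordan chains $v_{\tau,1},\dots,v_{\tau,r(\tau)}$, $1\le\tau\le\ell$, $r(\tau)\ge1$, with $$A(j)v_{\tau,1}=\lambda v_{\tau,1},\qquad A(j)v_{\tau,k+1}=\lambda v_{\tau,k+1}+v_{\tau,k}\quad(1\le k<r(\tau)).$$ Let $r^M(\lambda,j)=\max_\tau r(\tau)$, and let $V_{s,\tau}$ be the $r^M(\lambda,j)\times r(\tau)$ matrix whose entry in row $a$ and column $b$ is $C^s(j)v_{\tau,b-a+1}$ if $a\le b$, and $0$ if $a>b$. For $\lambda\in\Lambda^1\cap\Lambda^2$ let $\mathcal V^{\lambda,j}_s$ be the matrix $(V_{s,1}\ \cdots\ V_{s,\ell})$ formed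 for $A(j)$, $C(j)$ and $\lambda$, with zero rows appended at the bottom so that it has $\max(r^M(\lambda,1),r^M(\lambda,2))$ rows. Let $\operatorname{Null}$ denote the dimension of the null space of a complex matrix. Consider the condition $$(*)\qquad\text{there is }\lambda\in\Lambda^1\cap\Lambda^2\text{ with }\operatorname{Null}\begin{pmatrix}\mathcal V^{\lambda,1}_s&\mathcal V^{\lambda,2}_s\end{pmatrix}>\operatorname{Null}\mathcal V^{\lambda,1}_s+\operatorname{Null}\mathcal V^{\lambda,2}_s .$$ Then there exists an admissible attack that, for every initial state $x_0$ and every time $t$, is not unambiguously identifiable at time $t$, if and only if $(*)$ holds. If $(*)$ does not hold, then every admissible attack is, for every initial state $x_0$, unambiguously identifiable at some time $t\le 2n-1$. -/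

import Mathlib

open scoped Matrix

noncomputable section

namespace MovingTarget

variable {n m p : ℕ}

/-! The deterministic system under a sensor attack:
`x (k+1) = A k * x k`, `y k = C k * x k + D * d k`. -/

/-- The attack matrix `D` (size `m × p`) of an ordered set `L` of `p` distinct sensors:
`D u v = 1` if `u` is the `v`-th sensor of `L`, and `0` otherwise. -/
def attackMatrix (L : Fin p ↪ Fin m) : Matrix (Fin m) (Fin p) ℝ :=
  Matrix.of fun u v => if u = L v then 1 else 0

/-- The state trajectory with initial state `x₀`. -/
def state (A : ℕ → Matrix (Fin n) (Fin n) ℝ) (x₀ : Fin n → ℝ) : ℕ → Fin n → ℝ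
  | 0 => x₀
  | k + 1 => A k *ᵥ state A x₀ k

/-- The output `y(x₀, D d, k)` at time `k`. -/
def output (A : ℕ → Matrix (Fin n) (Fin n) ℝ) (C : ℕ → Matrix (Fin m) (Fin n) ℝ)
    (L : Fin p ↪ Fin m) (x₀ : Fin n → ℝ) (d : ℕ → Fin p → ℝ) (k : ℕ) : Fin m → ℝ :=
  C k *ᵥ state A x₀ k + attackMatrix L *ᵥ d k

/-- The attack signal `k ↦ Dˢ d k` on sensor `s`. -/
def sensorAttack (L : Fin p ↪ Fin m) (d : ℕ → Fin p → ℝ) (s : Fin m) (k : ℕ) : ℝ :=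
  (attackMatrix L *ᵥ d k) s

/-- The attack `d` on sensor `s` is unambiguously identifiable at time `t` (the true initial
state being `x₀`): no initial state `x'` explains the readings of sensor `s` at times
`0, …, t` without an attack. -/
def UnambiguouslyIdentifiableAt (A : ℕ → Matrix (Fin n) (Fin n) ℝ)
    (C : ℕ → Matrix (Fin m) (Fin n) ℝ) (L : Fin p ↪ Fin m) (x₀ : Fin n → ℝ)
    (d : ℕ → Fin p → ℝ) (s : Fin m) (t : ℕ) : Prop :=
  ¬ ∃ x' : Fin n → ℝ, ∀ k ≤ t, output A C L x₀ d k s = output A C L x' 0 k s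

/-- The observability matrix of sensor `s` over `t` time steps, with rows `Cˢ A ^ k`,
`k = 0, …, t - 1`. -/
def observabilityMatrix (A : Matrix (Fin n) (Fin n) ℝ) (C : Matrix (Fin m) (Fin n) ℝ)
    (s : Fin m) (t : ℕ) : Matrix (Fin t) (Fin n) ℝ :=
  Matrix.of fun k => (C * A ^ (k : ℕ)) s

/-- The attack `d` on sensor `s` is inserted along the image of the observability matrices of
the mode `(A, C)`: at every horizon `t`, the first `t` attack values on sensor `s` form a
vector in the image of the observability matrix over `t` steps. -/
def AlongObservabilityImage (A : Matrix (Fin n) (Fin n) ℝ) (C : Matrix (Fin m) (Fin n) ℝ)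
    (L : Fin p ↪ Fin m) (d : ℕ → Fin p → ℝ) (s : Fin m) : Prop :=
  ∀ t : ℕ, (fun k : Fin t => sensorAttack L d s k) ∈
    LinearMap.range (observabilityMatrix A C s t).mulVecLin

/-- The complexification of a real square matrix, as an endomorphism of `ℂⁿ`. -/
abbrev complexEnd (A : Matrix (Fin n) (Fin n) ℝ) : Module.End ℂ (Fin n → ℂ) :=
  Matrix.toLin' (A.map Complex.ofReal)

/-- The set `Λ` of (distinct, complex) eigenvalues of `A`. -/
abbrev Eigenvalue (A : Matrix (Fin n) (Fin n) ℝ) : Type :=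
  Module.End.Eigenvalues (complexEnd A)

/-- A maximal linearly independent set of generalized eigenvectors of `A` for the eigenvalue
`μ`, arranged in `ℓ` Jordan chains; the `τ`-th chain has length `r τ ≥ 1`. -/
structure JordanChains (A : Matrix (Fin n) (Fin n) ℝ) (μ : ℂ) where
  ℓ : ℕ
  r : Fin ℓ → ℕ
  r_pos : ∀ τ, 0 < r τ
  v : (τ : Fin ℓ) → Fin (r τ) → (Fin n → ℂ)
  eigen : ∀ τ, complexEnd A (v τ ⟨0, r_pos τ⟩) = μ • v τ ⟨0, r_pos τ⟩
  chain : ∀ (τ : Fin ℓ) (k : ℕ) (hk : k + 1 < r τ),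
    complexEnd A (v τ ⟨k + 1, hk⟩) = μ • v τ ⟨k + 1, hk⟩ + v τ ⟨k, Nat.lt_of_succ_lt hk⟩
  linearIndependent : LinearIndependent ℂ (fun q : (τ : Fin ℓ) × Fin (r τ) => v q.1 q.2)
  maximal : (complexEnd A).maxGenEigenspace μ ≤
    Submodule.span ℂ (Set.range fun q : (τ : Fin ℓ) × Fin (r τ) => v q.1 q.2)

namespace JordanChains

variable {A : Matrix (Fin n) (Fin n) ℝ} {μ : ℂ}

/-- The length of the longest chain. -/
def rMax (J : JordanChains A μ) : ℕ := Finset.univ.sup J.r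

/-- The number `Cˢ v` for a complex vector `v`. -/
def rowOutput (C : Matrix (Fin m) (Fin n) ℝ) (s : Fin m) (v : Fin n → ℂ) : ℂ :=
  (fun i => (C s i : ℂ)) ⬝ᵥ v

/-- The upper triangular Toeplitz block of the `τ`-th chain, with first row
`Cˢ v₁, …, Cˢ v_r`, diagonal entries `Cˢ v₁`, and zero rows below row `r`. -/
def block (J : JordanChains A μ) (C : Matrix (Fin m) (Fin n) ℝ) (s : Fin m) (τ : Fin J.ℓ) :
    Matrix (Fin J.rMax) (Fin (J.r τ)) ℂ :=
  Matrix.of fun i j =>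
    if (i : ℕ) ≤ (j : ℕ) then
      rowOutput C s (J.v τ ⟨(j : ℕ) - (i : ℕ), lt_of_le_of_lt (Nat.sub_le _ _) j.isLt⟩)
    else 0

/-- The blocks of all chains side by side, padded below by zero rows to `N` rows
(used with `J.rMax ≤ N`). -/
def stacked (J : JordanChains A μ) (C : Matrix (Fin m) (Fin n) ℝ) (s : Fin m) (N : ℕ) :
    Matrix (Fin N) ((τ : Fin J.ℓ) × Fin (J.r τ)) ℂ :=
  Matrix.of fun i q => if h : (i : ℕ) < J.rMax then J.block C s q.1 ⟨i, h⟩ q.2 else 0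

end JordanChains

/-- The dimension of the null space of a complex matrix. -/
def nullity {ι κ : Type*} [Fintype κ] (M : Matrix ι κ ℂ) : ℕ :=
  Module.finrank ℂ (LinearMap.ker M.mulVecLin)

/-- The nullity condition at one pair of eigenvalues; both stacked matrices are padded to the
same number of rows, the larger of the two maximal chain lengths. -/
def NullityCondition {A₁ A₂ : Matrix (Fin n) (Fin n) ℝ} {μ₁ μ₂ : ℂ}
    (C₁ C₂ : Matrix (Fin m) (Fin n) ℝ) (s : Fin m)
    (J₁ : JordanChains A₁ μ₁) (J₂ : JordanChains A₂ μ₂) : Prop :=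
  let N := max J₁.rMax J₂.rMax
  nullity (Matrix.fromCols (J₁.stacked C₁ s N) (J₂.stacked C₂ s N)) >
    nullity (J₁.stacked C₁ s N) + nullity (J₂.stacked C₂ s N)

end MovingTarget

end

/-! By linearity the true initial state drops out: an attack on `s` escapes identification exactly
when its signal is itself an attack-free reading of mode 1, while admissibility makes it a nonzero
reading of mode 2. So the question is whether the two modes share a nonzero output sequence.

Over ℂ the shared output sequences form a finite-dimensional space invariant under the left shift.
If it is nonzero, it contains a shift eigenvector, which lifts to generalized eigenvectors of both
modes for one eigenvalue μ (`exists_common_eigenvalue`). In Jordan coordinates the stacked Toeplitz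
matrices send coefficients to the outputs of the nilpotent operators `A - μ`, so sharing a nonzero
output means that their column spaces meet nontrivially. By rank-nullity, this is the strict nullity
inequality.

The bound 2n comes from Cayley–Hamilton for the product of the two characteristic polynomials:
agreement for 2n steps is agreement forever. -/

namespace MovingTarget

/-! ### Output sequences of linear systems over a field -/

section Abstract

open Polynomial

variable {K V W : Type*} [Field K] [AddCommGroup V] [Module K V] [AddCommGroup W] [Module K W]

/-- If two linear systems have the same output sequence, then all polynomial combinations of
the outputs agree. -/
theorem apply_aeval_eq_of_forall_pow {T : Module.End K V} {S : Module.End K W}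
    {c : V →ₗ[K] K} {e : W →ₗ[K] K} {x : V} {y : W}
    (h : ∀ k, c ((T ^ k) x) = e ((S ^ k) y)) (q : K[X]) :
    c (aeval T q x) = e (aeval S q y) := by
  simp [aeval_eq_sum_range, LinearMap.sum_apply, h]

/-- The outputs of two linear systems agree forever as soon as they agree up to the sum of the
dimensions of the state spaces. -/
theorem output_eq_of_forall_lt [FiniteDimensional K V] [FiniteDimensional K W]
    {T : Module.End K V} {S : Module.End K W}
    {c : V →ₗ[K] K} {e : W →ₗ[K] K} {x : V} {y : W}
    (h : ∀ k < Module.finrank K V + Module.finrank K W, c ((T ^ k) x) = e ((S ^ k) y)) (k : ℕ) :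
    c ((T ^ k) x) = e ((S ^ k) y) := by
  -- The product annihilates both operators, so `X ^ k` may be replaced in both systems by the same
  -- remainder of degree below `natDegree p`.
  set p : K[X] := T.charpoly * S.charpoly with hp
  have hm : p.Monic := T.charpoly_monic.mul S.charpoly_monic
  have hd : p.natDegree = Module.finrank K V + Module.finrank K W := by
    rw [hp, T.charpoly_monic.natDegree_mul S.charpoly_monic, LinearMap.charpoly_natDegree,
      LinearMap.charpoly_natDegree]
  -- The strict degree bound on the remainder fails only for `p = 1`, when both spaces are zero.
  by_cases hp1 : p = 1
  · have h0 : T.charpoly.natDegree = 0 ∧ S.charpoly.natDegree = 0 := by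
      rw [hp1, natDegree_one] at hd
      rw [LinearMap.charpoly_natDegree, LinearMap.charpoly_natDegree]
      omega
    have hV : Module.finrank K V = 0 := by rw [← T.charpoly_natDegree]; exact h0.1
    have hW : Module.finrank K W = 0 := by rw [← S.charpoly_natDegree]; exact h0.2
    have := Module.finrank_zero_iff.mp hV
    have := Module.finrank_zero_iff.mp hW
    rw [Subsingleton.elim ((T ^ k) x) 0, Subsingleton.elim ((S ^ k) y) 0, map_zero, map_zero]
  have hlt : (X ^ k %ₘ p).natDegree < Module.finrank K V + Module.finrank K W :=
    hd ▸ natDegree_modByMonic_lt _ hm hp1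
  have hT : aeval T p = 0 := by rw [hp, map_mul, LinearMap.aeval_self_charpoly, zero_mul]
  have hS : aeval S p = 0 := by rw [hp, map_mul, LinearMap.aeval_self_charpoly, mul_zero]
  have eT : T ^ k = aeval T (X ^ k %ₘ p) := by
    rw [aeval_modByMonic_eq_self_of_root hT, map_pow, aeval_X]
  have eS : S ^ k = aeval S (X ^ k %ₘ p) := by
    rw [aeval_modByMonic_eq_self_of_root hS, map_pow, aeval_X]
  rw [eT, eS, aeval_eq_sum_range' hlt, aeval_eq_sum_range' hlt]
  simp only [LinearMap.sum_apply, LinearMap.smul_apply, map_sum, map_smul]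
  exact Finset.sum_congr rfl fun i hi => by rw [h i (Finset.mem_range.mp hi)]

/-- The output sequence of the linear system `(T, c)`, as a function of the initial state. -/
def outputSequence (T : Module.End K V) (c : V →ₗ[K] K) : V →ₗ[K] (ℕ → K) :=
  LinearMap.pi fun k => c ∘ₗ (T ^ k)

@[simp]
theorem outputSequence_apply (T : Module.End K V) (c : V →ₗ[K] K) (x : V) (k : ℕ) :
    outputSequence T c x k = c ((T ^ k) x) := rfl

/-- The left shift of sequences. -/
def shift (K : Type*) [Field K] : Module.End K (ℕ → K) := LinearMap.funLeft K K Nat.succ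

theorem shift_outputSequence (T : Module.End K V) (c : V →ₗ[K] K) (x : V) :
    shift K (outputSequence T c x) = outputSequence T c (T x) := by
  ext k
  simp [shift, LinearMap.funLeft_apply, pow_succ]

theorem aeval_shift_outputSequence (T : Module.End K V) (c : V →ₗ[K] K) (x : V) (q : K[X]) :
    aeval (shift K) q (outputSequence T c x) = outputSequence T c (aeval T q x) := by
  induction q using Polynomial.induction_on' with
  | add p q hp hq => simp [hp, hq]
  | monomial k a =>
    have h : ∀ (k : ℕ) (x : V), (shift K ^ k) (outputSequence T c x) =
        outputSequence T c ((T ^ k) x) := by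
      intro k
      induction k with
      | zero => simp
      | succ k ih => intro x; rw [pow_succ, pow_succ, Module.End.mul_apply, shift_outputSequence,
          ih, Module.End.mul_apply]
    simp [aeval_monomial, h, Algebra.algebraMap_eq_smul_one]

/-- An output sequence that is an eigenvector of the shift comes from an initial state in a
generalized eigenspace for the same eigenvalue. -/
theorem exists_mem_maxGenEigenspace_outputSequence_eq [FiniteDimensional K V]
    (T : Module.End K V) (c : V →ₗ[K] K) {μ : K} {u : ℕ → K}
    (hu : (shift K).HasEigenvector μ u) (hr : u ∈ LinearMap.range (outputSequence T c)) :
    T.HasEigenvalue μ ∧ ∃ x ∈ T.maxGenEigenspace μ, outputSequence T c x = u := by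
  obtain ⟨x, rfl⟩ := hr
  -- Factor the characteristic polynomial as `(X - μ) ^ r * g`. Applying `g` to `T` moves the state
  -- into the generalized eigenspace, and multiplies the output only by the nonzero scalar `g.eval
  -- μ`.
  obtain ⟨g, hg, hgd⟩ := exists_eq_pow_rootMultiplicity_mul_and_not_dvd T.charpoly
    T.charpoly_monic.ne_zero μ
  set r := T.charpoly.rootMultiplicity μ
  have hgμ : g.eval μ ≠ 0 := fun h => hgd (dvd_iff_isRoot.mpr h)
  set x' := (g.eval μ)⁻¹ • aeval T g x with hx'
  have hout : outputSequence T c x' = outputSequence T c x := by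
    rw [hx', map_smul, ← aeval_shift_outputSequence,
      Module.End.aeval_apply_of_hasEigenvector hu, smul_smul, inv_mul_cancel₀ hgμ, one_smul]
  have hmem : x' ∈ T.maxGenEigenspace μ := by
    rw [Module.End.mem_maxGenEigenspace]
    refine ⟨r, ?_⟩
    have h0 : aeval T T.charpoly x = 0 := by rw [LinearMap.aeval_self_charpoly]; rfl
    rw [hg, map_mul, map_pow, map_sub, aeval_X, aeval_C, Algebra.algebraMap_eq_smul_one,
      Module.End.mul_apply] at h0
    rw [hx', map_smul, h0, smul_zero]
  refine ⟨?_, x', hmem, hout⟩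
  have hne : x' ≠ 0 := by
    intro h
    apply hu.2
    rw [← hout, h, map_zero]
  by_contra hev
  have hbot : T.maxGenEigenspace μ = ⊥ := by
    rw [Submodule.eq_bot_iff]
    intro z hz
    obtain ⟨k, hk⟩ := (Module.End.mem_maxGenEigenspace T μ z).mp hz
    have hinj : Function.Injective (T - μ • (1 : Module.End K V)) := by
      rw [← LinearMap.ker_eq_bot]
      have := Module.End.hasEigenvalue_iff.not.mp hev
      rw [not_not, Module.End.eigenspace_def] at this
      exact this
    have hinj' : Function.Injective ⇑((T - μ • (1 : Module.End K V)) ^ k) := by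
      rw [Module.End.coe_pow]; exact hinj.iterate k
    exact hinj' (by rw [hk, map_zero])
  rw [hbot, Submodule.mem_bot] at hmem
  exact hne hmem

/-- If two systems share a nonzero output sequence, they share one that is generated by
generalized eigenvectors for a common eigenvalue. -/
theorem exists_common_eigenvalue [IsAlgClosed K] [FiniteDimensional K V] [FiniteDimensional K W]
    {T : Module.End K V} {S : Module.End K W} {c : V →ₗ[K] K} {e : W →ₗ[K] K} {x : V} {y : W}
    (hxy : outputSequence T c x = outputSequence S e y) (h0 : outputSequence T c x ≠ 0) :
    ∃ μ, T.HasEigenvalue μ ∧ S.HasEigenvalue μ ∧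
      ∃ x' ∈ T.maxGenEigenspace μ, ∃ y' ∈ S.maxGenEigenspace μ,
        outputSequence T c x' = outputSequence S e y' ∧ outputSequence T c x' ≠ 0 := by
  set U := LinearMap.range (outputSequence T c) ⊓ LinearMap.range (outputSequence S e) with hU
  have hinv : ∀ u ∈ U, shift K u ∈ U := by
    rintro u ⟨⟨a, ha⟩, ⟨b, hb⟩⟩
    exact ⟨⟨T a, by rw [← shift_outputSequence, ha]⟩, ⟨S b, by rw [← shift_outputSequence, hb]⟩⟩
  have hne : Nontrivial U :=
    ⟨⟨⟨_, ⟨x, rfl⟩, ⟨y, hxy.symm⟩⟩, 0, fun h => h0 (congrArg Subtype.val h)⟩⟩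
  have : FiniteDimensional K U := Submodule.finiteDimensional_inf_left _ _
  obtain ⟨μ, hμ⟩ := Module.End.exists_eigenvalue ((shift K).restrict hinv)
  obtain ⟨u, hu⟩ := hμ.exists_hasEigenvector
  have hu' : (shift K).HasEigenvector μ (u : ℕ → K) := by
    refine Module.End.hasEigenvector_iff.mpr ⟨Module.End.mem_eigenspace_iff.mpr ?_, ?_⟩
    · exact congrArg Subtype.val hu.apply_eq_smul
    · exact fun h => hu.2 (Subtype.ext h)
  obtain ⟨hT, x', hx', hxu⟩ := exists_mem_maxGenEigenspace_outputSequence_eq T c hu' u.2.1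
  obtain ⟨hS, y', hy', hyu⟩ := exists_mem_maxGenEigenspace_outputSequence_eq S e hu' u.2.2
  exact ⟨μ, hT, hS, x', hx', y', hy', hxu.trans hyu.symm, hxu ▸ hu'.2⟩

/-- Shifting both state operators by a scalar does not change whether the outputs agree. -/
theorem forall_output_eq_iff_sub_smul {T : Module.End K V} {S : Module.End K W}
    {c : V →ₗ[K] K} {e : W →ₗ[K] K} {x : V} {y : W} (μ : K) :
    (∀ k, c ((T ^ k) x) = e ((S ^ k) y)) ↔
      ∀ k, c (((T - μ • (1 : Module.End K V)) ^ k) x) =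
        e (((S - μ • (1 : Module.End K W)) ^ k) y) := by
  constructor
  · intro h k
    have := apply_aeval_eq_of_forall_pow h ((X - C μ) ^ k)
    simpa [Algebra.algebraMap_eq_smul_one] using this
  · intro h k
    -- Evaluated at the shifted operators, this polynomial gives back `T ^ k` and `S ^ k`.
    have := apply_aeval_eq_of_forall_pow h ((X + C μ) ^ k)
    simpa [Algebra.algebraMap_eq_smul_one] using this

end Abstract

/-! ### Nullity and intersection of column spaces -/

/-- Joining two matrices side by side increases the nullity beyond the sum of the nullities
exactly when the two column spaces intersect nontrivially. -/
theorem nullity_fromCols_gt_iff {ι κ₁ κ₂ : Type*} [Fintype ι] [Fintype κ₁] [Fintype κ₂]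
    (M : Matrix ι κ₁ ℂ) (N : Matrix ι κ₂ ℂ) :
    nullity (Matrix.fromCols M N) > nullity M + nullity N ↔
      ∃ a b, M *ᵥ a = N *ᵥ b ∧ M *ᵥ a ≠ 0 := by
  have hM := M.mulVecLin.finrank_range_add_finrank_ker
  have hN := N.mulVecLin.finrank_range_add_finrank_ker
  have hMN := (Matrix.fromCols M N).mulVecLin.finrank_range_add_finrank_ker
  have hsup : LinearMap.range (Matrix.fromCols M N).mulVecLin =
      LinearMap.range M.mulVecLin ⊔ LinearMap.range N.mulVecLin := by
    ext z
    simp only [Submodule.mem_sup, LinearMap.mem_range, Matrix.mulVecLin_apply]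
    constructor
    · rintro ⟨w, rfl⟩
      exact ⟨_, ⟨w ∘ Sum.inl, rfl⟩, _, ⟨w ∘ Sum.inr, rfl⟩, (Matrix.fromCols_mulVec M N w).symm⟩
    · rintro ⟨_, ⟨a, rfl⟩, _, ⟨b, rfl⟩, rfl⟩
      exact ⟨Sum.elim a b, Matrix.fromCols_mulVec_sumElim M N a b⟩
  have hdim := Submodule.finrank_sup_add_finrank_inf_eq
    (LinearMap.range M.mulVecLin) (LinearMap.range N.mulVecLin)
  rw [hsup] at hMN
  simp only [Module.finrank_fintype_fun_eq_card, Fintype.card_sum] at hM hN hMN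
  -- The excess of nullity equals the dimension of the intersection of the two ranges.
  have hinf : nullity (Matrix.fromCols M N) > nullity M + nullity N ↔
      0 < Module.finrank ℂ
        ↥(LinearMap.range M.mulVecLin ⊓ LinearMap.range N.mulVecLin) := by
    unfold nullity
    omega
  rw [hinf, Nat.pos_iff_ne_zero, Ne, Submodule.finrank_eq_zero, ← Ne, Submodule.ne_bot_iff]
  constructor
  · rintro ⟨_, ⟨⟨a, rfl⟩, ⟨b, hb⟩⟩, h0⟩
    exact ⟨a, b, hb.symm, h0⟩
  · rintro ⟨a, b, hab, h0⟩
    exact ⟨_, ⟨⟨a, rfl⟩, ⟨b, hab.symm⟩⟩, h0⟩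

/-! ### Jordan chains and the Toeplitz matrices -/

variable {n m p : ℕ}

/-- The output functional `v ↦ Cˢ v` on complex states. -/
def rowFunctional (C : Matrix (Fin m) (Fin n) ℝ) (s : Fin m) : (Fin n → ℂ) →ₗ[ℂ] ℂ where
  toFun := JordanChains.rowOutput C s
  map_add' _ _ := dotProduct_add _ _ _
  map_smul' _ _ := dotProduct_smul _ _ _

namespace JordanChains

variable {A : Matrix (Fin n) (Fin n) ℝ} {μ : ℂ} (J : JordanChains A μ)

/-- The linear combination of the chain vectors with given coefficients. -/
def combination : ((τ : Fin J.ℓ) × Fin (J.r τ) → ℂ) →ₗ[ℂ] (Fin n → ℂ) :=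
  Fintype.linearCombination ℂ fun q => J.v q.1 q.2

theorem r_le_rMax (τ : Fin J.ℓ) : J.r τ ≤ J.rMax := Finset.le_sup (Finset.mem_univ τ)

theorem sub_smul_pow_apply (i : ℕ) (τ : Fin J.ℓ) (j : Fin (J.r τ)) :
    ((complexEnd A - μ • (1 : Module.End ℂ (Fin n → ℂ))) ^ i) (J.v τ j) =
      if (i : ℕ) ≤ (j : ℕ) then
        J.v τ ⟨(j : ℕ) - i, lt_of_le_of_lt (Nat.sub_le _ _) j.isLt⟩ else 0 := by
  induction i generalizing j with
  | zero => simp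
  | succ i ih =>
    rw [pow_succ, Module.End.mul_apply]
    obtain ⟨j, hj⟩ := j
    cases j with
    | zero =>
      rw [LinearMap.sub_apply, J.eigen τ]
      simp
    | succ j =>
      have h := J.chain τ j hj
      have h' : (complexEnd A - μ • (1 : Module.End ℂ (Fin n → ℂ))) (J.v τ ⟨j + 1, hj⟩) =
          J.v τ ⟨j, Nat.lt_of_succ_lt hj⟩ := by
        rw [LinearMap.sub_apply, h]
        simp
      rw [h', ih]
      simp

/-- Each application of `A - μ` moves one place down a chain. Hence finitely many rows record the
whole shifted output, and padding by zero rows is correct. -/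
theorem sub_smul_pow_combination_eq_zero {i : ℕ} (hi : J.rMax ≤ i)
    (α : (τ : Fin J.ℓ) × Fin (J.r τ) → ℂ) :
    ((complexEnd A - μ • (1 : Module.End ℂ (Fin n → ℂ))) ^ i) (J.combination α) = 0 := by
  rw [combination, Fintype.linearCombination_apply, map_sum]
  refine Finset.sum_eq_zero fun q _ => ?_
  rw [map_smul, sub_smul_pow_apply, if_neg, smul_zero]
  have := J.r_le_rMax q.1
  have := q.2.isLt
  omega

theorem exists_combination_eq {x : Fin n → ℂ} (hx : x ∈ (complexEnd A).maxGenEigenspace μ) :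
    ∃ α, J.combination α = x := by
  have := J.maximal hx
  rw [← Fintype.range_linearCombination] at this
  exact this

/-- The Toeplitz entry in row `i` is the output of the chain vector moved down `i` places, or zero
once the chain is exhausted. -/
theorem stacked_mulVec_apply (C : Matrix (Fin m) (Fin n) ℝ) (s : Fin m) {N : ℕ}
    (α : (τ : Fin J.ℓ) × Fin (J.r τ) → ℂ) (i : Fin N) :
    (J.stacked C s N *ᵥ α) i = rowFunctional C s
      (((complexEnd A - μ • (1 : Module.End ℂ (Fin n → ℂ))) ^ (i : ℕ)) (J.combination α)) := by
  rw [combination, Fintype.linearCombination_apply, map_sum, map_sum, Matrix.mulVec, dotProduct]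
  refine Finset.sum_congr rfl fun q _ => ?_
  rw [map_smul, map_smul, smul_eq_mul, mul_comm, sub_smul_pow_apply]
  congr 1
  have hr := J.r_le_rMax q.1
  have hq := q.2.isLt
  by_cases h : (i : ℕ) ≤ (q.2 : ℕ)
  · have hi : (i : ℕ) < J.rMax := by omega
    rw [if_pos h]
    simp [stacked, block, hi, h]
    rfl
  · rw [if_neg h, map_zero]
    simp [stacked, block, h]

end JordanChains

/-- The nullity condition says that generalized eigenvectors for the common eigenvalue generate
a common nonzero output sequence. -/
theorem nullityCondition_iff {A₁ A₂ : Matrix (Fin n) (Fin n) ℝ} {μ μ' : ℂ} (hμ : μ = μ')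
    (C₁ C₂ : Matrix (Fin m) (Fin n) ℝ) (s : Fin m)
    (J₁ : JordanChains A₁ μ) (J₂ : JordanChains A₂ μ') :
    NullityCondition C₁ C₂ s J₁ J₂ ↔ ∃ α β,
      outputSequence (complexEnd A₁) (rowFunctional C₁ s) (J₁.combination α) =
        outputSequence (complexEnd A₂) (rowFunctional C₂ s) (J₂.combination β) ∧
      outputSequence (complexEnd A₁) (rowFunctional C₁ s) (J₁.combination α) ≠ 0 := by
  subst hμ
  have key : ∀ α β, J₁.stacked C₁ s (max J₁.rMax J₂.rMax) *ᵥ α =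
        J₂.stacked C₂ s (max J₁.rMax J₂.rMax) *ᵥ β ↔
      outputSequence (complexEnd A₁) (rowFunctional C₁ s) (J₁.combination α) =
        outputSequence (complexEnd A₂) (rowFunctional C₂ s) (J₂.combination β) := by
    intro α β
    rw [funext_iff, funext_iff]
    simp only [outputSequence_apply, JordanChains.stacked_mulVec_apply]
    rw [forall_output_eq_iff_sub_smul μ]
    constructor
    · intro h k
      by_cases hk : k < max J₁.rMax J₂.rMax
      · exact h ⟨k, hk⟩
      · rw [J₁.sub_smul_pow_combination_eq_zero (by omega),
          J₂.sub_smul_pow_combination_eq_zero (by omega), map_zero, map_zero]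
    · exact fun h k => h k
  refine (nullity_fromCols_gt_iff _ _).trans ?_
  refine exists_congr fun α => exists_congr fun β => and_congr (key α β) (not_congr ?_)
  -- Comparison with zero coefficients turns vanishing of the matrix product into vanishing of the
  -- output.
  simpa using key α 0

/-! ### Real readings and attacks -/

theorem state_const (A : Matrix (Fin n) (Fin n) ℝ) (x₀ : Fin n → ℝ) (k : ℕ) :
    state (fun _ => A) x₀ k = (A ^ k) *ᵥ x₀ := by
  induction k with
  | zero => simp [state]
  | succ k ih => rw [state, ih, Matrix.mulVec_mulVec, pow_succ']

/-- The attack-free reading of sensor `s` at time `k`. -/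
def reading (A : Matrix (Fin n) (Fin n) ℝ) (C : Matrix (Fin m) (Fin n) ℝ) (s : Fin m)
    (x : Fin n → ℝ) (k : ℕ) : ℝ := ((C * A ^ k) *ᵥ x) s

theorem output_const (A : Matrix (Fin n) (Fin n) ℝ) (C : Matrix (Fin m) (Fin n) ℝ)
    (L : Fin p ↪ Fin m) (x₀ : Fin n → ℝ) (d : ℕ → Fin p → ℝ) (k : ℕ) (s : Fin m) :
    output (fun _ => A) (fun _ => C) L x₀ d k s =
      reading A C s x₀ k + sensorAttack L d s k := by
  rw [output, state_const, Matrix.mulVec_mulVec]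
  rfl

theorem reading_sub (A : Matrix (Fin n) (Fin n) ℝ) (C : Matrix (Fin m) (Fin n) ℝ) (s : Fin m)
    (x y : Fin n → ℝ) (k : ℕ) : reading A C s (x - y) k = reading A C s x k - reading A C s y k := by
  simp [reading, Matrix.mulVec_sub]

theorem reading_add (A : Matrix (Fin n) (Fin n) ℝ) (C : Matrix (Fin m) (Fin n) ℝ) (s : Fin m)
    (x y : Fin n → ℝ) (k : ℕ) : reading A C s (x + y) k = reading A C s x k + reading A C s y k := by
  simp [reading, Matrix.mulVec_add]

theorem outputSequence_complexEnd (A : Matrix (Fin n) (Fin n) ℝ) (C : Matrix (Fin m) (Fin n) ℝ)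
    (s : Fin m) (z : Fin n → ℂ) (k : ℕ) :
    outputSequence (complexEnd A) (rowFunctional C s) z k =
      ∑ i, ((C * A ^ k) s i : ℂ) * z i := by
  have hpow : complexEnd A ^ k = Matrix.toLin' ((A ^ k).map Complex.ofReal) := by
    rw [← Matrix.toLin'_pow]
    congr 1
    exact (map_pow (Complex.ofRealHom.mapMatrix (m := Fin n)) A k).symm
  have hmul : ((C * A ^ k).map Complex.ofReal) =
      C.map Complex.ofReal * (A ^ k).map Complex.ofReal :=
    Matrix.map_mul (f := Complex.ofRealHom)
  rw [outputSequence_apply, hpow, Matrix.toLin'_apply]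
  change (C.map Complex.ofReal *ᵥ ((A ^ k).map Complex.ofReal *ᵥ z)) s = _
  rw [Matrix.mulVec_mulVec, ← hmul]
  rfl

theorem outputSequence_ofReal (A : Matrix (Fin n) (Fin n) ℝ) (C : Matrix (Fin m) (Fin n) ℝ)
    (s : Fin m) (x : Fin n → ℝ) (k : ℕ) :
    outputSequence (complexEnd A) (rowFunctional C s) (fun i => (x i : ℂ)) k =
      (reading A C s x k : ℂ) := by
  rw [outputSequence_complexEnd, reading, Matrix.mulVec, dotProduct]
  push_cast
  rfl

theorem re_outputSequence (A : Matrix (Fin n) (Fin n) ℝ) (C : Matrix (Fin m) (Fin n) ℝ)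
    (s : Fin m) (z : Fin n → ℂ) (k : ℕ) :
    (outputSequence (complexEnd A) (rowFunctional C s) z k).re =
      reading A C s (fun i => (z i).re) k := by
  rw [outputSequence_complexEnd, reading, Matrix.mulVec, dotProduct, Complex.re_sum]
  exact Finset.sum_congr rfl fun i _ => Complex.re_ofReal_mul _ _

/-- If two modes share a nonzero complex output sequence, they share a nonzero reading. -/
theorem exists_reading_eq_of_outputSequence_eq {A₁ A₂ : Matrix (Fin n) (Fin n) ℝ}
    {C₁ C₂ : Matrix (Fin m) (Fin n) ℝ} {s : Fin m} {x y : Fin n → ℂ}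
    (heq : outputSequence (complexEnd A₁) (rowFunctional C₁ s) x =
      outputSequence (complexEnd A₂) (rowFunctional C₂ s) y)
    (hne : outputSequence (complexEnd A₁) (rowFunctional C₁ s) x ≠ 0) :
    ∃ x y, reading A₁ C₁ s x = reading A₂ C₂ s y ∧ reading A₁ C₁ s x ≠ 0 := by
  obtain ⟨k, hk⟩ := Function.ne_iff.mp hne
  -- Dividing both states by this nonzero entry makes the output at `k` equal to 1, so taking real
  -- parts cannot kill it.
  set z := outputSequence (complexEnd A₁) (rowFunctional C₁ s) x k with hz
  refine ⟨fun i => ((z⁻¹ • x) i).re, fun i => ((z⁻¹ • y) i).re, funext fun j => ?_, fun h0 => ?_⟩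
  · rw [← re_outputSequence, ← re_outputSequence, map_smul, map_smul, heq]
  · have h1 := congrFun h0 k
    rw [← re_outputSequence, map_smul, Pi.smul_apply, ← hz, smul_eq_mul, inv_mul_cancel₀ hk] at h1
    exact one_ne_zero h1

/-- Readings of two modes that agree for `2 n` steps agree forever. -/
theorem reading_eq_of_forall_lt {A₁ A₂ : Matrix (Fin n) (Fin n) ℝ}
    {C₁ C₂ : Matrix (Fin m) (Fin n) ℝ} {s : Fin m} {x y : Fin n → ℝ}
    (h : ∀ k < 2 * n, reading A₁ C₁ s x k = reading A₂ C₂ s y k) (k : ℕ) :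
    reading A₁ C₁ s x k = reading A₂ C₂ s y k := by
  have := output_eq_of_forall_lt (T := complexEnd A₁) (S := complexEnd A₂)
    (c := rowFunctional C₁ s) (e := rowFunctional C₂ s)
    (x := fun i => (x i : ℂ)) (y := fun i => (y i : ℂ)) (by
      intro k hk
      rw [Module.finrank_fin_fun, ← two_mul] at hk
      rw [← outputSequence_apply, ← outputSequence_apply, outputSequence_ofReal,
        outputSequence_ofReal, h k hk]) k
  rw [← outputSequence_apply, ← outputSequence_apply, outputSequence_ofReal,
    outputSequence_ofReal] at this
  exact_mod_cast this

/-- An attack lies along the image of the observability matrices exactly when it is the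
attack-free reading of the mode from some initial state. -/
theorem alongObservabilityImage_iff {A : Matrix (Fin n) (Fin n) ℝ}
    {C : Matrix (Fin m) (Fin n) ℝ} {L : Fin p ↪ Fin m} {d : ℕ → Fin p → ℝ} {s : Fin m} :
    AlongObservabilityImage A C L d s ↔
      ∃ x, ∀ k, sensorAttack L d s k = reading A C s x k := by
  constructor
  · intro h
    have h' : ∀ t, ∃ x, ∀ k < t, reading A C s x k = sensorAttack L d s k := by
      intro t
      obtain ⟨x, hx⟩ := h t
      exact ⟨x, fun k hk => congrFun hx ⟨k, hk⟩⟩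
    obtain ⟨x, hx⟩ := h' (2 * n)
    refine ⟨x, fun k => ?_⟩
    -- The state explaining a longer horizon agrees in output with `x` for 2n steps, hence always;
    -- so `x` serves every horizon.
    obtain ⟨y, hy⟩ := h' (max (2 * n) (k + 1))
    rw [← hy k (by omega)]
    exact reading_eq_of_forall_lt (fun i hi => by rw [hx i hi, hy i (by omega)]) k
  · rintro ⟨x, hx⟩ t
    exact ⟨x, funext fun k => (hx k).symm⟩

/-- An attack escapes identification up to time `t` exactly when it agrees up to `t` with an
attack-free reading of the true mode. -/
theorem not_unambiguouslyIdentifiableAt_iff {A : Matrix (Fin n) (Fin n) ℝ}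
    {C : Matrix (Fin m) (Fin n) ℝ} {L : Fin p ↪ Fin m} {x₀ : Fin n → ℝ}
    {d : ℕ → Fin p → ℝ} {s : Fin m} {t : ℕ} :
    ¬ UnambiguouslyIdentifiableAt (fun _ => A) (fun _ => C) L x₀ d s t ↔
      ∃ x, ∀ k ≤ t, sensorAttack L d s k = reading A C s x k := by
  have h0 : ∀ k, sensorAttack L (0 : ℕ → Fin p → ℝ) s k = 0 := fun k => by simp [sensorAttack]
  simp only [UnambiguouslyIdentifiableAt, not_not, output_const, h0, add_zero]
  constructor
  · rintro ⟨x', hx'⟩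
    exact ⟨x' - x₀, fun k hk => by rw [reading_sub]; linarith [hx' k hk]⟩
  · rintro ⟨x, hx⟩
    exact ⟨x₀ + x, fun k hk => by rw [reading_add, hx k hk]⟩

/-- Every scalar signal is the signal of some attack on an attacked sensor. -/
theorem exists_sensorAttack_eq {L : Fin p ↪ Fin m} {s : Fin m} (hs : s ∈ Set.range L)
    (a : ℕ → ℝ) : ∃ d, sensorAttack L d s = a := by
  obtain ⟨v, rfl⟩ := hs
  exact ⟨fun k => Pi.single v (a k), funext fun k => by simp [sensorAttack, attackMatrix]⟩

/-- The nullity condition holds at a common eigenvalue exactly when the two modes share a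
nonzero attack-free reading. -/
theorem exists_nullityCondition_iff {A₁ A₂ : Matrix (Fin n) (Fin n) ℝ}
    {C₁ C₂ : Matrix (Fin m) (Fin n) ℝ} {s : Fin m}
    (J₁ : ∀ μ : Eigenvalue A₁, JordanChains A₁ (μ : ℂ))
    (J₂ : ∀ μ : Eigenvalue A₂, JordanChains A₂ (μ : ℂ)) :
    (∃ (μ₁ : Eigenvalue A₁) (μ₂ : Eigenvalue A₂),
        (μ₁ : ℂ) = (μ₂ : ℂ) ∧ NullityCondition C₁ C₂ s (J₁ μ₁) (J₂ μ₂)) ↔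
      ∃ x y, reading A₁ C₁ s x = reading A₂ C₂ s y ∧ reading A₁ C₁ s x ≠ 0 := by
  constructor
  · rintro ⟨μ₁, μ₂, hμ, h⟩
    obtain ⟨α, β, heq, hne⟩ := (nullityCondition_iff hμ C₁ C₂ s _ _).mp h
    exact exists_reading_eq_of_outputSequence_eq heq hne
  · rintro ⟨x, y, hxy, h0⟩
    have hseq : outputSequence (complexEnd A₁) (rowFunctional C₁ s) (fun i => (x i : ℂ)) =
        outputSequence (complexEnd A₂) (rowFunctional C₂ s) (fun i => (y i : ℂ)) :=
      funext fun k => by rw [outputSequence_ofReal, outputSequence_ofReal, hxy]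
    have hne : outputSequence (complexEnd A₁) (rowFunctional C₁ s) (fun i => (x i : ℂ)) ≠ 0 :=
      fun h => h0 <| funext fun k => by
        have := congrFun h k
        rw [outputSequence_ofReal, Pi.zero_apply, Complex.ofReal_eq_zero] at this
        rw [this, Pi.zero_apply]
    obtain ⟨μ, h₁, h₂, x', hx', y', hy', heq, hne'⟩ := exists_common_eigenvalue hseq hne
    obtain ⟨μ₁, hμ₁⟩ : ∃ μ₁ : Eigenvalue A₁, (μ₁ : ℂ) = μ := ⟨⟨μ, h₁⟩, rfl⟩
    obtain ⟨μ₂, hμ₂⟩ : ∃ μ₂ : Eigenvalue A₂, (μ₂ : ℂ) = μ := ⟨⟨μ, h₂⟩, rfl⟩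
    rw [← hμ₁] at hx'
    rw [← hμ₂] at hy'
    obtain ⟨α, rfl⟩ := (J₁ μ₁).exists_combination_eq hx'
    obtain ⟨β, rfl⟩ := (J₂ μ₂).exists_combination_eq hy'
    have hμ : (μ₁ : ℂ) = μ₂ := hμ₁.trans hμ₂.symm
    exact ⟨μ₁, μ₂, hμ, (nullityCondition_iff hμ C₁ C₂ s _ _).mpr ⟨α, β, heq, hne'⟩⟩

end MovingTarget

/-! ### The main equivalence and the identification time -/

theorem theorem2 {n m p : ℕ}
    (A₁ A₂ : Matrix (Fin n) (Fin n) ℝ) (C₁ C₂ : Matrix (Fin m) (Fin n) ℝ)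
    (L : Fin p ↪ Fin m) (s : Fin m) (hs : s ∈ Set.range L)
    (J₁ : ∀ μ : MovingTarget.Eigenvalue A₁, MovingTarget.JordanChains A₁ (μ : ℂ))
    (J₂ : ∀ μ : MovingTarget.Eigenvalue A₂, MovingTarget.JordanChains A₂ (μ : ℂ)) :
    ((∃ d : ℕ → Fin p → ℝ,
        MovingTarget.sensorAttack L d s ≠ 0 ∧
        MovingTarget.AlongObservabilityImage A₂ C₂ L d s ∧
        ∀ (x₀ : Fin n → ℝ) (t : ℕ),
          ¬ MovingTarget.UnambiguouslyIdentifiableAt (fun _ => A₁) (fun _ => C₁) L x₀ d s t) ↔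
      ∃ (μ₁ : MovingTarget.Eigenvalue A₁) (μ₂ : MovingTarget.Eigenvalue A₂),
        (μ₁ : ℂ) = (μ₂ : ℂ) ∧ MovingTarget.NullityCondition C₁ C₂ s (J₁ μ₁) (J₂ μ₂)) ∧
    ((¬ ∃ (μ₁ : MovingTarget.Eigenvalue A₁) (μ₂ : MovingTarget.Eigenvalue A₂),
        (μ₁ : ℂ) = (μ₂ : ℂ) ∧ MovingTarget.NullityCondition C₁ C₂ s (J₁ μ₁) (J₂ μ₂)) →
      ∀ d : ℕ → Fin p → ℝ,
        MovingTarget.sensorAttack L d s ≠ 0 →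
        MovingTarget.AlongObservabilityImage A₂ C₂ L d s →
        ∀ x₀ : Fin n → ℝ, ∃ t : ℕ, t + 1 ≤ 2 * n ∧
          MovingTarget.UnambiguouslyIdentifiableAt (fun _ => A₁) (fun _ => C₁) L x₀ d s t) := by
  rw [MovingTarget.exists_nullityCondition_iff]
  refine ⟨⟨?_, ?_⟩, ?_⟩
  · rintro ⟨d, hd, hobs, hid⟩
    obtain ⟨y, hy⟩ := MovingTarget.alongObservabilityImage_iff.mp hobs
    -- The explaining state may depend on `t`; viewing the attack as lying in the images for mode 1
    -- yields one state for all times.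
    have hobs₁ : MovingTarget.AlongObservabilityImage A₁ C₁ L d s := by
      intro t
      obtain ⟨x, hx⟩ := MovingTarget.not_unambiguouslyIdentifiableAt_iff.mp (hid 0 t)
      exact ⟨x, funext fun k => (hx k k.isLt.le).symm⟩
    obtain ⟨x, hx⟩ := MovingTarget.alongObservabilityImage_iff.mp hobs₁
    refine ⟨x, y, funext fun k => (hx k).symm.trans (hy k), fun h => hd ?_⟩
    rw [← h]
    exact funext hx
  · rintro ⟨x, y, hxy, h0⟩
    obtain ⟨d, hd⟩ := MovingTarget.exists_sensorAttack_eq hs (MovingTarget.reading A₁ C₁ s x)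
    refine ⟨d, hd ▸ h0, MovingTarget.alongObservabilityImage_iff.mpr
      ⟨y, fun k => by rw [hd, hxy]⟩, fun x₀ t => ?_⟩
    exact MovingTarget.not_unambiguouslyIdentifiableAt_iff.mpr ⟨x, fun k _ => by rw [hd]⟩
  · intro hno d hd hobs x₀
    obtain ⟨y, hy⟩ := MovingTarget.alongObservabilityImage_iff.mp hobs
    -- For `n = 0` the attack would vanish. Positivity makes `2 * n - 1` a genuine subtraction;
    -- times up to it are exactly 2n samples.
    have hn : 0 < n := by
      rw [Nat.pos_iff_ne_zero]
      rintro rfl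
      refine hd (funext fun k => ?_)
      simp [hy, MovingTarget.reading, Matrix.mulVec, dotProduct]
    refine ⟨2 * n - 1, by omega, ?_⟩
    by_contra hid
    obtain ⟨x, hx⟩ := MovingTarget.not_unambiguouslyIdentifiableAt_iff.mp hid
    have hxy : MovingTarget.reading A₁ C₁ s x = MovingTarget.reading A₂ C₂ s y :=
      funext <| MovingTarget.reading_eq_of_forall_lt fun k hk => by
        rw [← hy, hx k (by omega)]
    refine hno ⟨x, y, hxy, fun h => hd ?_⟩
    rw [← h, hxy]
    exact funext hy
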